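/- Let $\mathcal X\subset\mathbb R^L$ be a Borel set, $p$ a Borel probability measure on $\mathcal X$ with a density with respect to Lebesgue measure, $g:\mathcal X\to\mathbb R^M$ a Borel map, and $W\in C^3(\mathbb R^M)$ real-valued. Assume that there are a function $\psi:\mathcal X\to\mathbb R_+$ with $\psi(X)\ge\|g(X)\|^2$ and with $\{X:\psi(X)\le A\}$ compact for every $A>0$, and a convex increasing function $f:[0,\infty)\to[1,\infty)$, such that $|W(a)|+\|DW(a)\|+\|DW(a)\|^2\le\psi(X)f(\|a\|^2)$ for all $a\in\mathbb R^M$, $X\in\mathcal X$, and $E_p[\psi^2(X)f(\psi(X))]<\infty$. Let $\Delta(\mathcal X)$ be the space of Borel probability measures on $\mathcal X$, and for $\mu\in\Delta(\mathcal X)$ put $a(\mu)=\int g\,d\mu$. An autoencoder is a Borel probability measure $\tau$ on $\Delta(\mathcal X)$ with $\int\mu\,d\tau(\mu)=p$; it is optimal if it maximizes $\int W(a(\mu))\,d\tau(\mu)$ among all autoencoders. Its optimal feature manifold $\Xi\subset\mathbb R^M$ is the support of the law of $a(\mu)$ under $\tau$ (equivalently, of the $a$-marginal of the joint law of $(a,X)$,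 where $\mu\sim\tau$, $a=a(\mu)$ and $X\sim\mu$). Let $\nu_+(A)$ be the number of non-negative eigenvalues of a symmetric matrix $A$, counted with multiplicity. **Theorem.** Let $\Xi$ be the optimal feature manifold of an optimal autoencoder $\tau$, and let $B\subset\mathbb R^M$ be open. Then $\Xi\cap B$ is contained in a Lipschitz manifold of some dimension $d\le\sup_{a\in B}\nu_+(D^2W(a))$ (with $\sup\emptyset=0$), in the following sense of local Lipschitz coordinates: for every $a_0\in\Xi\cap B$ there are $\varepsilon>0$, a $d$-dimensional linear subspace $V\subset\mathbb R^M$ and a Lipschitz map $f:V\to V^\perp$ such that $\Xi\cap B\cap B_\varepsilon(a_0)\subset\{v+f(v):v\in V\}$. -/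

import Mathlib

open MeasureTheory Set

noncomputable section

namespace BenignAutoencoder

/-! ### Optimal autoencoders

`𝒳` is the state space, `Δ(𝒳) = ProbabilityMeasure 𝒳` (its σ-algebra in Mathlib is generated by the
evaluations `μ ↦ μ s`, which for a separable metrizable `𝒳` is the Borel σ-algebra of the weak
topology), and an autoencoder for the prior `p` is a `τ ∈ Δ(Δ(𝒳))` with barycenter `p`. -/

section Autoencoder

variable {𝒳 : Type*} [MeasurableSpace 𝒳] {M : ℕ}

/-- The representation `a(μ)` of the posterior `μ`: the solution of `∫ (a - g(X)) dμ(X) = 0`,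
that is, `a(μ) = ∫ g dμ`. -/
def representation (g : 𝒳 → EuclideanSpace ℝ (Fin M)) (μ : ProbabilityMeasure 𝒳) :
    EuclideanSpace ℝ (Fin M) :=
  ∫ x, g x ∂(μ : Measure 𝒳)

/-- `τ` is an autoencoder for the prior `p`: `∫ μ dτ(μ) = p`. -/
def IsAutoencoder (p : ProbabilityMeasure 𝒳)
    (τ : ProbabilityMeasure (ProbabilityMeasure 𝒳)) : Prop :=
  ∀ s : Set 𝒳, MeasurableSet s →
    ∫⁻ μ, (μ : Measure 𝒳) s ∂(τ : Measure (ProbabilityMeasure 𝒳)) = (p : Measure 𝒳) s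

/-- The value of `τ`, i.e. `∫ W̄(μ) dτ(μ)` with `W̄(μ) = ∫ W(a(μ)) dμ(X)`. -/
def value (g : 𝒳 → EuclideanSpace ℝ (Fin M)) (W : EuclideanSpace ℝ (Fin M) → ℝ)
    (τ : ProbabilityMeasure (ProbabilityMeasure 𝒳)) : ℝ :=
  ∫ μ, (∫ _x, W (representation g μ) ∂(μ : Measure 𝒳)) ∂(τ : Measure (ProbabilityMeasure 𝒳))

/-- `τ` is an optimal autoencoder: it maximizes the value among all autoencoders for `p`. -/
def IsOptimalAutoencoder (p : ProbabilityMeasure 𝒳) (g : 𝒳 → EuclideanSpace ℝ (Fin M))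
    (W : EuclideanSpace ℝ (Fin M) → ℝ) (τ : ProbabilityMeasure (ProbabilityMeasure 𝒳)) : Prop :=
  IsAutoencoder p τ ∧ ∀ τ', IsAutoencoder p τ' → value g W τ' ≤ value g W τ

/-- The feature manifold of `τ`: the support of the `a`-marginal of the joint law of `(a, X)`, where
`μ` is drawn from `τ`, `a = a(μ)`, and `X` is drawn from `μ`; this marginal is the law of `a(μ)`
under `τ`. -/
def featureManifold (g : 𝒳 → EuclideanSpace ℝ (Fin M))
    (τ : ProbabilityMeasure (ProbabilityMeasure 𝒳)) : Set (EuclideanSpace ℝ (Fin M)) :=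
  ((τ : Measure (ProbabilityMeasure 𝒳)).map (representation g)).support

/-- The growth and integrability assumption under which all values are finite. -/
def IntegrabilityAssumption [TopologicalSpace 𝒳] (p : ProbabilityMeasure 𝒳)
    (g : 𝒳 → EuclideanSpace ℝ (Fin M)) (W : EuclideanSpace ℝ (Fin M) → ℝ) : Prop :=
  ∃ (ψ : 𝒳 → ℝ) (f : ℝ → ℝ),
    (∀ x, ‖g x‖ ^ 2 ≤ ψ x) ∧
    (∀ A : ℝ, 0 < A → IsCompact {x | ψ x ≤ A}) ∧
    ConvexOn ℝ (Ici 0) f ∧ MonotoneOn f (Ici 0) ∧ (∀ t, 0 ≤ t → 1 ≤ f t) ∧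
    (∀ a x, |W a| + ‖fderiv ℝ W a‖ + ‖fderiv ℝ W a‖ ^ 2 ≤ ψ x * f (‖a‖ ^ 2)) ∧
    Integrable (fun x => ψ x ^ 2 * f (ψ x)) (p : Measure 𝒳)

end Autoencoder

/-! ### Local degree of convexity -/

/-- The Hessian matrix of `W` at `a`. -/
def hessian {M : ℕ} (W : EuclideanSpace ℝ (Fin M) → ℝ) (a : EuclideanSpace ℝ (Fin M)) :
    Matrix (Fin M) (Fin M) ℝ :=
  Matrix.of fun i j =>
    fderiv ℝ (fderiv ℝ W) a (EuclideanSpace.single i 1) (EuclideanSpace.single j 1)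

/-- The number of non-negative eigenvalues of a symmetric matrix, with multiplicity. -/
def nuPlus {M : ℕ} (A : Matrix (Fin M) (Fin M) ℝ) : ℕ :=
  Multiset.card (A.charpoly.roots.filter fun t => 0 ≤ t)

/-! ### Lipschitz manifolds -/

/-- `N` is a `d`-dimensional Lipschitz graph: the graph `{v + f(v)}` of a Lipschitz map `f` from a
`d`-dimensional linear subspace to its orthogonal complement. -/
def IsLipschitzGraph {M : ℕ} (d : ℕ) (N : Set (EuclideanSpace ℝ (Fin M))) : Prop :=
  ∃ V : Submodule ℝ (EuclideanSpace ℝ (Fin M)), Module.finrank ℝ V = d ∧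
    ∃ (f : V → Vᗮ) (K : NNReal), LipschitzWith K f ∧
      N = range fun v : V => (v : EuclideanSpace ℝ (Fin M)) + (f v : EuclideanSpace ℝ (Fin M))

/-- `S` is contained in a `d`-dimensional Lipschitz manifold, in the sense of local Lipschitz
coordinates: near each of its points, `S` lies in a `d`-dimensional Lipschitz graph. -/
def InLipschitzManifold {M : ℕ} (d : ℕ) (S : Set (EuclideanSpace ℝ (Fin M))) : Prop :=
  ∀ a ∈ S, ∃ ε > 0, ∃ N, IsLipschitzGraph d N ∧ S ∩ Metric.ball a ε ⊆ N

end BenignAutoencoder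

end

/-!
Let `Ξ` be the support of the law of `a(μ)` under an optimal `τ`. Optimality forces the midpoint
convexity inequality for `W` on every chord between two points of `Ξ`, and to second order this
confines short chords to a cone around the eigenspaces of the Hessian with non-negative eigenvalues.

*Pooling.* If `σ ≤ τ` is a nonzero measure on `Δ(𝒳)`, then `τ - σ` plus a point mass at the
normalized barycenter of `σ` is again an autoencoder. Optimality gives `W(⨍ a dσ) ≤ ⨍ W(a) dσ`
(`IsOptimalAutoencoder.map_average_le`). All integrals here converge, because the growth assumption
and Jensen's inequality bound `W(a(μ))` (`IntegrabilityAssumption.integrable_map_representation`).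
For `x, y ∈ Ξ`, take for `σ` a multiple of `τ` restricted to `{a(μ) near x}` plus one of `τ`
restricted to `{a(μ) near y}`, of equal masses. As the neighbourhoods shrink, this gives
`W((x + y) / 2) ≤ (W(x) + W(y)) / 2` (`IsOptimalAutoencoder.map_midpoint_le`).

*Cones.* Near `a`, the second difference of `W` along the chord from `x` to `y` is
`D²W(a)(x - y, x - y) / 4` up to an error `η ‖x - y‖²`, with `η` as small as desired
(`exists_second_difference_le`), so on `Ξ` this quadratic form is at least `-4 η ‖x - y‖²`. Let `V`
be a span of eigenvectors of `D²W(a)` that includes all those with non-negative eigenvalues. The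
Hessian is negative definite on `Vᗮ`, hence the component of `x - y` in `Vᗮ` is bounded by a
multiple of its component in `V`, that is, `Ξ` near `a` is a Lipschitz graph over a subset of `V`.
The graph extends to all of `V` because Lipschitz maps into a finite-dimensional space do
(`exists_ball_inter_subset_lipschitzGraph`). Since `V` may be larger than needed, the same
`d = sup ν₊` works at every point of `B`.
-/

open ProbabilityTheory Filter Topology

namespace BenignAutoencoder

/-! ### Autoencoders as kernels -/

section Pooling

variable {𝒳 : Type*} [MeasurableSpace 𝒳] {M : ℕ}

/-- The tautological kernel `μ ↦ μ` from `Δ(𝒳)` to `𝒳`. Composing it with a measure on `Δ(𝒳)`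
gives the barycenter of that measure. -/
def posteriorKernel (𝒳 : Type*) [MeasurableSpace 𝒳] : Kernel (ProbabilityMeasure 𝒳) 𝒳 where
  toFun μ := μ
  measurable' := measurable_subtype_coe

@[simp] lemma posteriorKernel_apply (μ : ProbabilityMeasure 𝒳) :
    posteriorKernel 𝒳 μ = (μ : Measure 𝒳) := rfl

instance : IsMarkovKernel (posteriorKernel 𝒳) where
  isProbabilityMeasure μ := by rw [posteriorKernel_apply]; infer_instance

lemma isAutoencoder_iff_comp_eq {p : ProbabilityMeasure 𝒳}
    {τ : ProbabilityMeasure (ProbabilityMeasure 𝒳)} :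
    IsAutoencoder p τ ↔
      posteriorKernel 𝒳 ∘ₘ (τ : Measure (ProbabilityMeasure 𝒳)) = (p : Measure 𝒳) := by
  constructor
  · intro h
    ext s hs
    rw [Measure.bind_apply hs (posteriorKernel 𝒳).aemeasurable]
    exact h s hs
  · intro h s hs
    rw [← h, Measure.bind_apply hs (posteriorKernel 𝒳).aemeasurable]
    rfl

lemma integral_comp_measure {α β E : Type*} [MeasurableSpace α] [MeasurableSpace β]
    [NormedAddCommGroup E] [NormedSpace ℝ E] {κ : Kernel α β} {μ : Measure α} {f : β → E}
    (hf : Integrable f (κ ∘ₘ μ)) : ∫ y, f y ∂(κ ∘ₘ μ) = ∫ x, ∫ y, f y ∂κ x ∂μ := by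
  rw [Measure.comp_eq_comp_const_apply] at hf ⊢
  rw [Kernel.integral_comp hf, Kernel.const_apply]

lemma integrable_integral_of_integrable_comp {α β E : Type*} [MeasurableSpace α]
    [MeasurableSpace β] [NormedAddCommGroup E] [NormedSpace ℝ E] {κ : Kernel α β} {μ : Measure α}
    {f : β → E} (hf : Integrable f (κ ∘ₘ μ)) : Integrable (fun x => ∫ y, f y ∂κ x) μ := by
  rw [Measure.comp_eq_comp_const_apply] at hf
  simpa using hf.integral_comp

variable {p : ProbabilityMeasure 𝒳} {g : 𝒳 → EuclideanSpace ℝ (Fin M)}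
  {W : EuclideanSpace ℝ (Fin M) → ℝ} {τ : ProbabilityMeasure (ProbabilityMeasure 𝒳)}

lemma stronglyMeasurable_representation (hg : Measurable g) :
    StronglyMeasurable (representation g) :=
  hg.stronglyMeasurable.integral_kernel (κ := posteriorKernel 𝒳)

lemma integrable_representation (hτ : IsAutoencoder p τ) (hgi : Integrable g (p : Measure 𝒳)) :
    Integrable (representation g) (τ : Measure (ProbabilityMeasure 𝒳)) := by
  rw [← isAutoencoder_iff_comp_eq.1 hτ] at hgi
  exact integrable_integral_of_integrable_comp hgi

lemma value_eq_integral (g : 𝒳 → EuclideanSpace ℝ (Fin M)) (W : EuclideanSpace ℝ (Fin M) → ℝ)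
    (τ : ProbabilityMeasure (ProbabilityMeasure 𝒳)) :
    value g W τ = ∫ μ, W (representation g μ) ∂(τ : Measure (ProbabilityMeasure 𝒳)) := by
  simp [value]

/-! ### Pooling posteriors -/

/-- Replacing a part `σ` of `τ` by a point mass at its barycenter `∫ μ dσ / σ(Δ(𝒳))` gives again an
autoencoder. Its value does not exceed the optimum, so pooling does not raise the value on `σ`. -/
lemma IsOptimalAutoencoder.map_average_le (hτ : IsOptimalAutoencoder p g W τ) (hg : Measurable g)
    (hW : Continuous W) (hgi : Integrable g (p : Measure 𝒳))
    (hWi : Integrable (fun μ => W (representation g μ)) (τ : Measure (ProbabilityMeasure 𝒳)))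
    {σ : Measure (ProbabilityMeasure 𝒳)} [NeZero σ]
    (hσ : σ ≤ (τ : Measure (ProbabilityMeasure 𝒳))) :
    W (⨍ μ, representation g μ ∂σ) ≤ ⨍ μ, W (representation g μ) ∂σ := by
  have : IsFiniteMeasure σ := isFiniteMeasure_of_le _ hσ
  have hσ0 : σ univ ≠ 0 := by simpa using NeZero.ne σ
  have hcomp := isAutoencoder_iff_comp_eq.1 hτ.1
  have hsplit := Measure.sub_add_cancel_of_le hσ
  set ρ := (τ : Measure (ProbabilityMeasure 𝒳)) - σ with hρ
  let μs : ProbabilityMeasure 𝒳 :=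
    ⟨posteriorKernel 𝒳 ∘ₘ ((σ univ)⁻¹ • σ), inferInstance⟩
  have hμs : (μs : Measure 𝒳) = (σ univ)⁻¹ • (posteriorKernel 𝒳 ∘ₘ σ) := Measure.comp_smul _
  let τ' : ProbabilityMeasure (ProbabilityMeasure 𝒳) := ⟨ρ + σ univ • Measure.dirac μs, ⟨by
    have h1 : (ρ + σ) univ = 1 := by rw [hsplit]; exact measure_univ
    simpa using h1⟩⟩
  have hτ' : IsAutoencoder p τ' := by
    rw [isAutoencoder_iff_comp_eq, ← hcomp]
    change posteriorKernel 𝒳 ∘ₘ (ρ + σ univ • Measure.dirac μs) = _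
    conv_rhs => rw [← hsplit]
    rw [Measure.comp_add, Measure.comp_add, Measure.comp_smul,
      Measure.dirac_bind (posteriorKernel 𝒳).measurable, posteriorKernel_apply, hμs, smul_smul,
      ENNReal.mul_inv_cancel hσ0 (measure_ne_top _ _), one_smul]
  have hrep : representation g μs = ⨍ μ, representation g μ ∂σ := by
    have hle : posteriorKernel 𝒳 ∘ₘ σ ≤ (p : Measure 𝒳) := by
      rw [← hcomp, ← hsplit, Measure.comp_add]
      exact Measure.le_add_left le_rfl
    have hgμ : Integrable g (posteriorKernel 𝒳 ∘ₘ ((σ univ)⁻¹ • σ)) := by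
      rw [Measure.comp_smul]
      exact (hgi.mono_measure hle).smul_measure (ENNReal.inv_ne_top.2 hσ0)
    exact integral_comp_measure hgμ
  have hopt := hτ.2 τ' hτ'
  have hρi : Integrable (fun μ => W (representation g μ)) ρ :=
    hWi.mono_measure (by rw [← hsplit]; exact Measure.le_add_right le_rfl)
  have hσi : Integrable (fun μ => W (representation g μ)) σ := hWi.mono_measure hσ
  have hsm : StronglyMeasurable (fun μ => W (representation g μ)) :=
    hW.comp_stronglyMeasurable (stronglyMeasurable_representation hg)
  have hdi : Integrable (fun μ => W (representation g μ)) (σ univ • Measure.dirac μs) :=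
    (integrable_dirac' hsm enorm_lt_top).smul_measure (measure_ne_top _ _)
  rw [value_eq_integral, value_eq_integral] at hopt
  change ∫ μ, W (representation g μ) ∂(ρ + σ univ • Measure.dirac μs) ≤ _ at hopt
  rw [← hsplit, integral_add_measure hρi hdi, integral_add_measure hρi hσi, integral_smul_measure,
    integral_dirac' _ _ hsm, hrep, add_le_add_iff_left, smul_eq_mul] at hopt
  rw [average_eq _ (fun μ => W (representation g μ)), smul_eq_mul, Measure.real, inv_mul_eq_div,
    le_div_iff₀ (ENNReal.toReal_pos hσ0 (measure_ne_top _ _)), mul_comm]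
  exact hopt

/-- The cross weights give the two restrictions the same mass `μ s * μ t / 2`, whether or not `s`
and `t` overlap. -/
lemma average_cross_weighted {α E : Type*} [MeasurableSpace α] [NormedAddCommGroup E]
    [NormedSpace ℝ E] {μ : Measure α} [IsFiniteMeasure μ] {s t : Set α} (hs : μ s ≠ 0)
    (ht : μ t ≠ 0) {h : α → E} (hh : Integrable h μ) :
    ⨍ x, h x ∂((μ t / 2) • μ.restrict s + (μ s / 2) • μ.restrict t) =
      (2⁻¹ : ℝ) • (⨍ x in s, h x ∂μ + ⨍ x in t, h x ∂μ) := by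
  have h2 (u : Set α) : μ u / 2 ≠ ⊤ := ENNReal.div_ne_top (measure_ne_top _ _) (by simp)
  have hs' : (μ s).toReal ≠ 0 := (ENNReal.toReal_pos hs (measure_ne_top _ _)).ne'
  have ht' : (μ t).toReal ≠ 0 := (ENNReal.toReal_pos ht (measure_ne_top _ _)).ne'
  have hfin (u : Set α) : IsFiniteMeasure ((μ u / 2) • μ) := Measure.smul_finite _ (h2 u)
  rw [average_eq, integral_add_measure (hh.restrict.smul_measure (h2 t))
    (hh.restrict.smul_measure (h2 s)), integral_smul_measure, integral_smul_measure,
    setAverage_eq, setAverage_eq, Measure.real, Measure.add_apply, Measure.smul_apply,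
    Measure.smul_apply, Measure.restrict_apply_univ, Measure.restrict_apply_univ, smul_eq_mul,
    smul_eq_mul, ENNReal.toReal_add (ENNReal.mul_ne_top (h2 t) (measure_ne_top _ _))
    (ENNReal.mul_ne_top (h2 s) (measure_ne_top _ _)), ENNReal.toReal_mul, ENNReal.toReal_mul,
    ENNReal.toReal_div, ENNReal.toReal_div, smul_add, smul_add, smul_smul, smul_smul, smul_smul,
    smul_smul, Measure.real, Measure.real]
  congr 2 <;> simp <;> field_simp <;> ring

/-- Features of an optimal autoencoder are not worth pooling: along every chord between two of them,
`W` at the midpoint is at most the mean of its values at the ends. -/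
lemma IsOptimalAutoencoder.map_midpoint_le (hτ : IsOptimalAutoencoder p g W τ) (hg : Measurable g)
    (hW : Continuous W) (hgi : Integrable g (p : Measure 𝒳))
    (hWi : Integrable (fun μ => W (representation g μ)) (τ : Measure (ProbabilityMeasure 𝒳)))
    {a b : EuclideanSpace ℝ (Fin M)} (ha : a ∈ featureManifold g τ)
    (hb : b ∈ featureManifold g τ) :
    W ((2⁻¹ : ℝ) • (a + b)) ≤ 2⁻¹ * (W a + W b) := by
  have hr := stronglyMeasurable_representation (𝒳 := 𝒳) hg
  set T := (τ : Measure (ProbabilityMeasure 𝒳))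
  refine le_of_forall_pos_le_add fun η hη => ?_
  have hloc (c : EuclideanSpace ℝ (Fin M)) :
      ∀ᶠ δ in 𝓝[>] (0 : ℝ), ∀ x ∈ Metric.closedBall c δ, |W x - W c| ≤ η / 2 := by
    obtain ⟨δ, hδ, h⟩ := Metric.continuous_iff.1 hW c (η / 2) (half_pos hη)
    filter_upwards [Ioo_mem_nhdsGT hδ] with δ' hδ' x hx
    exact (h x ((Metric.mem_closedBall.1 hx).trans_lt hδ'.2)).le
  obtain ⟨δ, ⟨⟨hδa, hδb⟩, hδm⟩, hδ : 0 < δ⟩ :=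
    ((((hloc a).and (hloc b)).and (hloc ((2⁻¹ : ℝ) • (a + b)))).and self_mem_nhdsWithin).exists
  let A (c : EuclideanSpace ℝ (Fin M)) : Set (ProbabilityMeasure 𝒳) :=
    representation g ⁻¹' Metric.closedBall c δ
  have hAm (c) : MeasurableSet (A c) := hr.measurable Metric.isClosed_closedBall.measurableSet
  have hA {c} (hc : c ∈ featureManifold g τ) : T (A c) ≠ 0 := by
    have := (Measure.mem_support_iff_forall c).1 hc _ (Metric.closedBall_mem_nhds c hδ)
    rw [Measure.map_apply hr.measurable Metric.isClosed_closedBall.measurableSet] at this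
    exact this.ne'
  have hmem (c) : ∀ᵐ μ ∂T.restrict (A c), representation g μ ∈ Metric.closedBall c δ :=
    ae_restrict_mem (hAm c)
  have hri := integrable_representation hτ.1 hgi
  have hx {c} (hc : c ∈ featureManifold g τ) :
      ⨍ μ in A c, representation g μ ∂T ∈ Metric.closedBall c δ :=
    (convex_closedBall c δ).set_average_mem Metric.isClosed_closedBall (hA hc)
      (measure_ne_top _ _) (hmem c) hri.integrableOn
  have hw {c} (hc : c ∈ featureManifold g τ)
      (hδc : ∀ x ∈ Metric.closedBall c δ, |W x - W c| ≤ η / 2) :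
      ⨍ μ in A c, W (representation g μ) ∂T ∈ Iic (W c + η / 2) := by
    refine (convex_Iic _).set_average_mem isClosed_Iic (hA hc) (measure_ne_top _ _) ?_
      hWi.integrableOn
    filter_upwards [hmem c] with μ hμ
    have := (abs_le.1 (hδc _ hμ)).2
    simp only [mem_Iic]; linarith
  set σ := (T (A b) / 2) • T.restrict (A a) + (T (A a) / 2) • T.restrict (A b) with hσdef
  have hσ : σ ≤ T := by
    refine Measure.le_iff.2 fun s _ => ?_
    calc σ s = T (A b) / 2 * T.restrict (A a) s + T (A a) / 2 * T.restrict (A b) s := rfl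
      _ ≤ 1 / 2 * T s + 1 / 2 * T s := by
          gcongr
          exacts [prob_le_one, Measure.restrict_le_self, prob_le_one, Measure.restrict_le_self]
      _ = T s := by rw [← add_mul, one_div, ENNReal.inv_two_add_inv_two, one_mul]
  have : NeZero σ := ⟨fun h => by
    have h1 : σ univ = T (A b) / 2 * T (A a) + T (A a) / 2 * T (A b) := by simp [hσdef]
    rw [h, Measure.coe_zero, Pi.zero_apply, eq_comm, add_eq_zero, mul_eq_zero] at h1
    exact h1.1.elim (by simpa using hA hb) (hA ha)⟩
  have key := hτ.map_average_le hg hW hgi hWi hσ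
  rw [hσdef, average_cross_weighted (hA ha) (hA hb) hri,
    average_cross_weighted (hA ha) (hA hb) hWi, smul_eq_mul] at key
  have hm := hδm ((2⁻¹ : ℝ) • (⨍ μ in A a, representation g μ ∂T +
    ⨍ μ in A b, representation g μ ∂T)) (by
      have h1 := hx ha
      have h2 := hx hb
      rw [mem_closedBall_iff_norm] at h1 h2 ⊢
      rw [← smul_sub, norm_smul, add_sub_add_comm, Real.norm_of_nonneg (by norm_num)]
      linarith [norm_add_le (⨍ μ in A a, representation g μ ∂T - a)
        (⨍ μ in A b, representation g μ ∂T - b)])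
  have h1 := hw ha hδa
  have h2 := hw hb hδb
  rw [mem_Iic] at h1 h2
  linarith [(abs_le.1 hm).1]

end Pooling
/-! ### Finiteness of the values -/

section Integrability

lemma _root_.ConvexOn.comp_norm_sq {E : Type*} [NormedAddCommGroup E] [NormedSpace ℝ E] {f : ℝ → ℝ}
    (hf : ConvexOn ℝ (Ici 0) f) (hmono : MonotoneOn f (Ici 0)) :
    ConvexOn ℝ univ fun y : E => f (‖y‖ ^ 2) := by
  have hnn (y : E) : ‖y‖ ^ 2 ∈ Ici (0 : ℝ) := sq_nonneg ‖y‖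
  have hsq : ConvexOn ℝ univ fun y : E => ‖y‖ ^ 2 :=
    (convexOn_norm convex_univ).pow (fun y _ => norm_nonneg y) 2
  refine ⟨convex_univ, fun x _ y _ s t hs ht hst => ?_⟩
  exact (hmono (hnn _) ((convex_Ici 0) (hnn x) (hnn y) hs ht hst)
    (hsq.2 (mem_univ x) (mem_univ y) hs ht hst)).trans (hf.2 (hnn x) (hnn y) hs ht hst)

variable {𝒳 : Type*} [MeasurableSpace 𝒳] [TopologicalSpace 𝒳] {M : ℕ} {p : ProbabilityMeasure 𝒳}
  {g : 𝒳 → EuclideanSpace ℝ (Fin M)} {W : EuclideanSpace ℝ (Fin M) → ℝ}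
  {τ : ProbabilityMeasure (ProbabilityMeasure 𝒳)}

lemma IntegrabilityAssumption.integrable (hint : IntegrabilityAssumption p g W)
    (hg : Measurable g) : Integrable g (p : Measure 𝒳) := by
  obtain ⟨ψ, f, hψ, -, -, -, hf1, -, hi⟩ := hint
  refine (hi.add (integrable_const (1 : ℝ))).mono' hg.aestronglyMeasurable (ae_of_all _ fun x => ?_)
  have h0 : 0 ≤ ψ x := (sq_nonneg _).trans (hψ x)
  have h1 := hf1 _ h0
  have h2 : ψ x ^ 2 ≤ ψ x ^ 2 * f (ψ x) := le_mul_of_one_le_right (sq_nonneg _) h1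
  simp only [Pi.add_apply]
  nlinarith [hψ x, sq_nonneg (‖g x‖ - 1 / 2), sq_nonneg (ψ x - 1 / 2)]

/-- Fixing the state in the growth bound gives `|W(a)| ≤ c f(‖a‖²)`. As `y ↦ f(‖y‖²)` is convex,
Jensen's inequality bounds `|W(a(μ))|` by `c ∫ f(‖g‖²) dμ`, whose `τ`-integral is
`c ∫ f(‖g‖²) dp`. -/
lemma IntegrabilityAssumption.integrable_map_representation (hint : IntegrabilityAssumption p g W)
    (hg : Measurable g) (hW : Continuous W) (hτ : IsAutoencoder p τ) :
    Integrable (fun μ => W (representation g μ)) (τ : Measure (ProbabilityMeasure 𝒳)) := by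
  have hgi := hint.integrable hg
  obtain ⟨ψ, f, hψ, -, hconv, hmono, hf1, hWf, hi⟩ := hint
  have hψ0 (x) : 0 ≤ ψ x := (sq_nonneg _).trans (hψ x)
  have hG := hconv.comp_norm_sq (E := EuclideanSpace ℝ (Fin M)) hmono
  have hGc : Continuous fun y : EuclideanSpace ℝ (Fin M) => f (‖y‖ ^ 2) :=
    continuousOn_univ.1 (hG.continuousOn isOpen_univ)
  have hGi : Integrable (fun x => f (‖g x‖ ^ 2)) (p : Measure 𝒳) := by
    refine (hi.add (integrable_const (f 1))).mono' (hGc.measurable.comp hg).aestronglyMeasurable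
      (ae_of_all _ fun x => ?_)
    have h1 := hf1 _ (hψ0 x)
    have h2 : f (‖g x‖ ^ 2) ≤ f (ψ x) := hmono (sq_nonneg ‖g x‖) (hψ0 x) (hψ x)
    rw [Real.norm_of_nonneg (zero_le_one.trans (hf1 _ (sq_nonneg _)))]
    refine h2.trans ?_
    rcases le_total (ψ x) 1 with h | h
    · have h3 : f (ψ x) ≤ f 1 := hmono (hψ0 x) (mem_Ici.2 zero_le_one) h
      exact h3.trans (le_add_of_nonneg_left (by positivity))
    · have h3 := hf1 1 zero_le_one
      exact (le_mul_of_one_le_left (by linarith) (one_le_pow₀ h)).trans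
        (le_add_of_nonneg_right (by linarith))
  have hcomp := isAutoencoder_iff_comp_eq.1 hτ
  have hgi' := hgi
  rw [← hcomp] at hgi' hGi
  obtain ⟨x₀⟩ : Nonempty 𝒳 := p.nonempty
  refine ((integrable_integral_of_integrable_comp hGi).const_mul (ψ x₀)).mono'
    (hW.comp_stronglyMeasurable (stronglyMeasurable_representation hg)).aestronglyMeasurable ?_
  filter_upwards [Measure.ae_integrable_of_integrable_comp hgi',
    Measure.ae_integrable_of_integrable_comp hGi] with μ hμ hGμ
  rw [posteriorKernel_apply] at hμ hGμ
  have hJ : f (‖representation g μ‖ ^ 2) ≤ ∫ x, f (‖g x‖ ^ 2) ∂(μ : Measure 𝒳) :=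
    hG.map_integral_le hGc.continuousOn isClosed_univ (ae_of_all _ fun _ => mem_univ _) hμ hGμ
  rw [Real.norm_eq_abs, posteriorKernel_apply]
  have hb := hWf (representation g μ) x₀
  have h1 : |W (representation g μ)| ≤ ψ x₀ * f (‖representation g μ‖ ^ 2) := by
    linarith [norm_nonneg (fderiv ℝ W (representation g μ)),
      sq_nonneg ‖fderiv ℝ W (representation g μ)‖]
  exact h1.trans (mul_le_mul_of_nonneg_left hJ (hψ0 x₀))

end Integrability
/-! ### Second differences and the Hessian -/

/-- Strict differentiability of the derivative bounds the second difference of `W` along a short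
chord by the second derivative at `a`, with an error uniform over nearby chords. -/
lemma exists_second_difference_le {E : Type*} [NormedAddCommGroup E] [NormedSpace ℝ E] {W : E → ℝ}
    (hW : ContDiff ℝ 2 W) (a : E) {η : ℝ} (hη : 0 < η) :
    ∃ ε > 0, ∀ x ∈ Metric.ball a ε, ∀ y ∈ Metric.ball a ε,
      W x + W y - 2 * W ((2⁻¹ : ℝ) • (x + y)) ≤
        4⁻¹ * fderiv ℝ (fderiv ℝ W) a (x - y) (x - y) + η * ‖x - y‖ ^ 2 := by
  have hstrict : HasStrictFDerivAt (fderiv ℝ W) (fderiv ℝ (fderiv ℝ W) a) a :=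
    ((hW.fderiv_right (m := 1) (by norm_num)).contDiffAt).hasStrictFDerivAt one_ne_zero
  set H := fderiv ℝ (fderiv ℝ W) a
  have hlo := hstrict.isLittleO.def hη
  rw [nhds_prod_eq] at hlo
  obtain ⟨ε, hε, hε'⟩ := Metric.eventually_nhds_iff_ball.1
    (nhds_prod_eq (x := a) (y := a) ▸ hlo : ∀ᶠ q in 𝓝 (a, a), _)
  refine ⟨ε, hε, fun x hx y hy => ?_⟩
  set m := (2⁻¹ : ℝ) • (x + y) with hm
  set h := (2⁻¹ : ℝ) • (x - y) with hh
  have hd (z : E) : HasFDerivAt W (fderiv ℝ W z) z :=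
    (hW.differentiable (by norm_num) z).hasFDerivAt
  have hline (k : E) (t : ℝ) :
      HasDerivAt (fun t : ℝ => W (m + t • k)) (fderiv ℝ W (m + t • k) k) t := by
    have h1 : HasDerivAt (fun t : ℝ => m + t • k) k t := by
      simpa using ((hasDerivAt_id t).smul_const k).const_add m
    exact (hd _).comp_hasDerivAt t h1
  -- The mean value theorem on `[0, 1]` for this function needs only first derivatives of `W`.
  have hφ (t : ℝ) : HasDerivAt
      (fun t : ℝ => W (m + t • h) + W (m + t • -h) - t ^ 2 * H h h)
      (fderiv ℝ W (m + t • h) h + fderiv ℝ W (m + t • -h) (-h) - 2 * t * H h h) t := by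
    simpa only [Nat.cast_ofNat, Nat.add_one_sub_one, pow_one] using!
      ((hline h t).add (hline (-h) t)).sub ((hasDerivAt_pow 2 t).mul_const (H h h))
  obtain ⟨c, ⟨hc0, hc1⟩, hc⟩ := exists_hasDerivAt_eq_slope _ _ zero_lt_one
    (fun t _ => (hφ t).continuousAt.continuousWithinAt) (fun t _ => hφ t)
  have hball {s : ℝ} (hs : |s| ≤ 1) : m + s • h ∈ Metric.ball a ε := by
    obtain ⟨hs1, hs2⟩ := abs_le.1 hs
    have : m + s • h = ((1 + s) / 2) • x + ((1 - s) / 2) • y := by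
      rw [hm, hh]; module
    rw [this]
    exact convex_ball a ε hx hy (by linarith) (by linarith) (by ring)
  have hx1 : m + c • h ∈ Metric.ball a ε := hball (abs_le.2 ⟨by linarith, hc1.le⟩)
  have hy1 : m + c • -h ∈ Metric.ball a ε := by
    rw [smul_neg, ← neg_smul]
    exact hball (abs_le.2 ⟨by linarith, by linarith⟩)
  have hest := hε' (m + c • h, m + c • -h) (by
    rw [← ball_prod_same]; exact ⟨hx1, hy1⟩)
  -- The estimate is applied at the chord scaled by `c`, whose ends stay in the ball by convexity.
  have hdiff : m + c • h - (m + c • -h) = (2 * c) • h := by module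
  simp only [hdiff] at hest
  have hop := (Real.le_norm_self _).trans ((fderiv ℝ W (m + c • h) - fderiv ℝ W (m + c • -h)
    - H ((2 * c) • h)).le_of_opNorm_le hest h)
  have hn : ‖h‖ = 2⁻¹ * ‖x - y‖ := by rw [hh, norm_smul]; norm_num
  have hH : H h h = 4⁻¹ * H (x - y) (x - y) := by
    rw [hh]; simp only [map_smul, FunLike.coe_smul, Pi.smul_apply, smul_eq_mul]; ring
  have e1 : m + (1 : ℝ) • h = x := by rw [hm, hh]; module
  have e2 : m + (1 : ℝ) • -h = y := by rw [hm, hh]; module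
  rw [norm_smul, Real.norm_of_nonneg (by linarith : (0 : ℝ) ≤ 2 * c)] at hop
  simp only [FunLike.coe_sub, Pi.sub_apply, map_smul, FunLike.coe_smul,
    Pi.smul_apply, smul_eq_mul] at hop
  simp only [e1, e2, zero_smul, add_zero, map_neg, sub_zero, div_one, one_pow, one_mul,
    zero_pow two_ne_zero, zero_mul] at hc
  have hc2 : η * (2 * c * ‖h‖) * ‖h‖ ≤ η * ‖x - y‖ ^ 2 := by
    rw [hn]
    nlinarith [mul_nonneg hη.le (sq_nonneg ‖x - y‖)]
  rw [← hH]
  linarith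

/-! ### The quadratic form of the Hessian -/

section Spectral

variable {M : ℕ} {W : EuclideanSpace ℝ (Fin M) → ℝ}

lemma isHermitian_hessian (hW : ContDiff ℝ 2 W) (a : EuclideanSpace ℝ (Fin M)) :
    (hessian W a).IsHermitian := by
  ext i j
  have := (hW.contDiffAt (x := a)).isSymmSndFDerivAt (by simp)
  simpa [hessian] using this (EuclideanSpace.single j 1) (EuclideanSpace.single i 1)

lemma nuPlus_eq_card {A : Matrix (Fin M) (Fin M) ℝ} (hA : A.IsHermitian) :
    nuPlus A = (Finset.univ.filter fun i => 0 ≤ hA.eigenvalues i).card := by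
  rw [nuPlus, hA.roots_charpoly_eq_eigenvalues, Multiset.filter_map, Multiset.card_map]
  rfl

lemma nuPlus_le (A : Matrix (Fin M) (Fin M) ℝ) : nuPlus A ≤ M := by
  refine (Multiset.card_le_card (Multiset.filter_le _ _)).trans ?_
  simpa using A.charpoly.card_roots'

lemma fderiv_fderiv_eigenvectorBasis (hW : ContDiff ℝ 2 W) (a : EuclideanSpace ℝ (Fin M))
    (i : Fin M) (w : EuclideanSpace ℝ (Fin M)) :
    fderiv ℝ (fderiv ℝ W) a w ((isHermitian_hessian hW a).eigenvectorBasis i) =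
      (isHermitian_hessian hW a).eigenvalues i *
        inner ℝ ((isHermitian_hessian hW a).eigenvectorBasis i) w := by
  set hA := isHermitian_hessian hW a
  set b := hA.eigenvectorBasis i
  have hsum (v : EuclideanSpace ℝ (Fin M)) : v = ∑ j, v j • EuclideanSpace.single j (1 : ℝ) := by
    simpa using ((EuclideanSpace.basisFun (Fin M) ℝ).sum_repr v).symm
  have hcoord (j : Fin M) : fderiv ℝ (fderiv ℝ W) a (EuclideanSpace.single j 1) b =
      hA.eigenvalues i * b j := by
    have h := congrFun (hA.mulVec_eigenvectorBasis i) j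
    simp only [Pi.smul_apply, smul_eq_mul] at h
    rw [← h]
    conv_lhs => rw [hsum b]
    simp [Matrix.mulVec, dotProduct, hessian, b, mul_comm]
  conv_lhs => rw [hsum w]
  simp [hcoord, PiLp.inner_apply, Finset.mul_sum, mul_left_comm]

lemma fderiv_fderiv_self (hW : ContDiff ℝ 2 W) (a v : EuclideanSpace ℝ (Fin M)) :
    fderiv ℝ (fderiv ℝ W) a v v = ∑ i, (isHermitian_hessian hW a).eigenvalues i *
      inner ℝ ((isHermitian_hessian hW a).eigenvectorBasis i) v ^ 2 := by
  conv_lhs => rhs; rw [← (isHermitian_hessian hW a).eigenvectorBasis.sum_repr' v]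
  rw [map_sum]
  refine Finset.sum_congr rfl fun i _ => ?_
  rw [map_smul, fderiv_fderiv_eigenvectorBasis hW, smul_eq_mul]
  ring

/-- `V` is spanned by `d` eigenvectors, among them all those with a non-negative eigenvalue; so the
Hessian is negative definite on `Vᗮ`, and `V` and `Vᗮ` are orthogonal for it. -/
lemma exists_subspace_hessian_le (hW : ContDiff ℝ 2 W) (a : EuclideanSpace ℝ (Fin M)) {d : ℕ}
    (hd : nuPlus (hessian W a) ≤ d) (hdM : d ≤ M) :
    ∃ V : Submodule ℝ (EuclideanSpace ℝ (Fin M)), Module.finrank ℝ V = d ∧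
      ∃ c > 0, ∃ C ≥ 0, ∀ u ∈ V, ∀ w ∈ Vᗮ,
        fderiv ℝ (fderiv ℝ W) a (u + w) (u + w) ≤ C * ‖u‖ ^ 2 - c * ‖w‖ ^ 2 := by
  set hA := isHermitian_hessian hW a
  rw [nuPlus_eq_card hA] at hd
  obtain ⟨J, hIJ, -, hJ⟩ := Finset.exists_subsuperset_card_eq (Finset.subset_univ _) hd (by simpa)
  set b := hA.eigenvectorBasis with hb
  have hneg (i) (hi : i ∉ J) : hA.eigenvalues i < 0 := by
    by_contra! h
    exact hi (hIJ (by simpa using h))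
  obtain ⟨c, hc, hc0 : 0 < c⟩ :
      ∃ c : ℝ, (∀ i, i ∉ J → hA.eigenvalues i ≤ -c) ∧ c ∈ Ioi 0 := by
    refine ((eventually_all.2 fun i => ?_).and self_mem_nhdsWithin : ∀ᶠ c in 𝓝[>] (0 : ℝ),
      (∀ i, i ∉ J → hA.eigenvalues i ≤ -c) ∧ c ∈ Ioi 0).exists
    by_cases hi : i ∈ J
    · simp [hi]
    · filter_upwards [Ioo_mem_nhdsGT (neg_pos.2 (hneg i hi))] with c hc _
      linarith [hc.2]
  refine ⟨Submodule.span ℝ (b '' J), ?_, c, hc0, ∑ i, |hA.eigenvalues i|,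
    Finset.sum_nonneg fun _ _ => abs_nonneg _, fun u hu w hw => ?_⟩
  · have hli : LinearIndependent ℝ fun j : J => b j :=
      b.orthonormal.linearIndependent.comp _ Subtype.val_injective
    have := finrank_span_eq_card hli
    rw [Fintype.card_coe, hJ] at this
    rw [← this, image_eq_range]
    rfl
  have hw0 (i) (hi : i ∈ J) : inner ℝ (b i) w = 0 :=
    Submodule.inner_right_of_mem_orthogonal (Submodule.subset_span (mem_image_of_mem b hi)) hw
  have hu0 (i) (hi : i ∉ J) : inner ℝ (b i) u = 0 := by
    have : Submodule.span ℝ (b '' J) ≤ (ℝ ∙ b i)ᗮ := by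
      rw [Submodule.span_le]
      rintro _ ⟨j, hj, rfl⟩
      rw [SetLike.mem_coe, Submodule.mem_orthogonal_singleton_iff_inner_right]
      exact b.orthonormal.2 fun h => hi (h ▸ hj)
    exact Submodule.mem_orthogonal_singleton_iff_inner_right.1 (this hu)
  rw [fderiv_fderiv_self hW, ← b.sum_sq_norm_inner_right u, ← b.sum_sq_norm_inner_right w,
    Finset.mul_sum, Finset.mul_sum, ← Finset.sum_sub_distrib]
  refine Finset.sum_le_sum fun i _ => ?_
  rw [← hb, inner_add_right, Real.norm_eq_abs, Real.norm_eq_abs, sq_abs, sq_abs]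
  by_cases hi : i ∈ J
  · rw [hw0 i hi]
    have : hA.eigenvalues i ≤ ∑ i, |hA.eigenvalues i| :=
      (le_abs_self _).trans (Finset.single_le_sum (f := fun i => |hA.eigenvalues i|)
        (fun _ _ => abs_nonneg _) (Finset.mem_univ i))
    nlinarith [sq_nonneg (inner ℝ (b i) u)]
  · rw [hu0 i hi]
    nlinarith [hc i hi, sq_nonneg (inner ℝ (b i) w)]

end Spectral

/-! ### Cone conditions and Lipschitz graphs -/

/-- A set whose chords all lie in a cone around `V` projects injectively to `V`, with a Lipschitz
inverse; the vertical coordinate then extends from the projection to all of `V`. -/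
lemma exists_isLipschitzGraph_of_cone {M d : ℕ} {V : Submodule ℝ (EuclideanSpace ℝ (Fin M))}
    (hV : Module.finrank ℝ V = d) {K : NNReal} {S : Set (EuclideanSpace ℝ (Fin M))}
    (hS : ∀ x ∈ S, ∀ y ∈ S,
      ‖Vᗮ.orthogonalProjectionOnto (x - y)‖ ≤ K * ‖V.orthogonalProjectionOnto (x - y)‖) :
    ∃ N, IsLipschitzGraph d N ∧ S ⊆ N := by
  let P : EuclideanSpace ℝ (Fin M) → V := V.orthogonalProjectionOnto
  have hinj : InjOn P S := fun x hx y hy hxy => by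
    have h1 : V.orthogonalProjectionOnto (x - y) = 0 := by rw [map_sub]; exact sub_eq_zero.2 hxy
    have h2 : ‖Vᗮ.orthogonalProjectionOnto (x - y)‖ ≤ 0 := by
      have h := hS x hx y hy
      rwa [h1, norm_zero, mul_zero] at h
    have h3 := Submodule.norm_sq_eq_add_norm_sq_projection (x - y) V
    rw [h1, h2.antisymm (norm_nonneg _)] at h3
    exact sub_eq_zero.1 (by simpa using h3)
  have hlip : LipschitzOnWith K (fun v => Vᗮ.orthogonalProjectionOnto (Function.invFunOn P S v))
      (P '' S) := by
    refine LipschitzOnWith.of_dist_le_mul ?_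
    rintro _ ⟨x, hx, rfl⟩ _ ⟨y, hy, rfl⟩
    simp only [hinj.leftInvOn_invFunOn hx, hinj.leftInvOn_invFunOn hy]
    rw [dist_eq_norm, dist_eq_norm, ← map_sub, ← map_sub]
    exact hS x hx y hy
  obtain ⟨f, hf, hfS⟩ := hlip.extend_finite_dimension
  refine ⟨_, ⟨V, hV, f, _, hf, rfl⟩, fun x hx => ⟨P x, ?_⟩⟩
  have := hfS (mem_image_of_mem P hx)
  simp only [hinj.leftInvOn_invFunOn hx] at this
  simp only [← this]
  exact V.starProjection_add_starProjection_orthogonal x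

/-- Near `a`, the midpoint inequality confines the chords of `S` to a cone around a span of `d`
eigenvectors of the Hessian that includes all those with a non-negative eigenvalue. -/
lemma exists_ball_inter_subset_lipschitzGraph {M d : ℕ} {W : EuclideanSpace ℝ (Fin M) → ℝ}
    (hW : ContDiff ℝ 2 W) {S : Set (EuclideanSpace ℝ (Fin M))}
    (hS : ∀ x ∈ S, ∀ y ∈ S, W ((2⁻¹ : ℝ) • (x + y)) ≤ 2⁻¹ * (W x + W y))
    (a : EuclideanSpace ℝ (Fin M)) (hd : nuPlus (hessian W a) ≤ d) (hdM : d ≤ M) :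
    ∃ ε > 0, ∃ N, IsLipschitzGraph d N ∧ S ∩ Metric.ball a ε ⊆ N := by
  obtain ⟨V, hV, c, hc, C, hC, hVc⟩ := exists_subspace_hessian_le hW a hd hdM
  -- With error `c / 8` at most half of the negative definite part is lost.
  obtain ⟨ε, hε, hdiff⟩ := exists_second_difference_le hW a (η := c / 8) (by positivity)
  refine ⟨ε, hε, exists_isLipschitzGraph_of_cone hV (K := ⟨√(2 * C / c + 1), by positivity⟩) ?_⟩
  rintro x ⟨hx, hxa⟩ y ⟨hy, hya⟩
  have h1 := hdiff x hxa y hya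
  have h2 := hS x hx y hy
  have hsum : (V.orthogonalProjectionOnto (x - y) : EuclideanSpace ℝ (Fin M)) +
      Vᗮ.orthogonalProjectionOnto (x - y) = x - y :=
    V.starProjection_add_starProjection_orthogonal (x - y)
  have h3 := hVc _ (V.orthogonalProjectionOnto (x - y)).2 _ (Vᗮ.orthogonalProjectionOnto (x - y)).2
  rw [hsum] at h3
  have h4 := Submodule.norm_sq_eq_add_norm_sq_projection (x - y) V
  set u := ‖V.orthogonalProjectionOnto (x - y)‖
  set w := ‖Vᗮ.orthogonalProjectionOnto (x - y)‖
  -- Four times the two inequalities, with `‖x - y‖² = u² + w²`: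
  -- `0 ≤ C u² - c w² + (c / 2) (u² + w²)`.
  have h5 : c * w ^ 2 ≤ (2 * C + c) * u ^ 2 := by
    rw [h4] at h1
    change _ ≤ C * u ^ 2 - c * w ^ 2 at h3
    linarith
  change w ≤ √(2 * C / c + 1) * u
  refine le_of_sq_le_sq ?_ (by positivity)
  rw [mul_pow, Real.sq_sqrt (by positivity), ← mul_le_mul_iff_right₀ hc]
  refine h5.trans_eq ?_
  field_simp

end BenignAutoencoder

theorem mainTheorem3 {L M : ℕ}
    (𝒳 : Set (EuclideanSpace ℝ (Fin L))) (h𝒳 : MeasurableSet 𝒳)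
    (p : ProbabilityMeasure 𝒳)
    (hp : (p : Measure 𝒳).map Subtype.val ≪ (volume : Measure (EuclideanSpace ℝ (Fin L))))
    (g : 𝒳 → EuclideanSpace ℝ (Fin M)) (hg : Measurable g)
    (W : EuclideanSpace ℝ (Fin M) → ℝ) (hW : ContDiff ℝ 3 W)
    (hint : BenignAutoencoder.IntegrabilityAssumption p g W)
    (τ : ProbabilityMeasure (ProbabilityMeasure 𝒳))
    (hτ : BenignAutoencoder.IsOptimalAutoencoder p g W τ)
    (B : Set (EuclideanSpace ℝ (Fin M))) (hB : IsOpen B) :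
    ∃ d : ℕ,
      d ≤ sSup ((fun a => BenignAutoencoder.nuPlus (BenignAutoencoder.hessian W a)) '' B) ∧
      BenignAutoencoder.InLipschitzManifold d (BenignAutoencoder.featureManifold g τ ∩ B) := by
  have hW2 : ContDiff ℝ 2 W := hW.of_le (by norm_num)
  have hbound : ∀ n ∈ (fun a => BenignAutoencoder.nuPlus (BenignAutoencoder.hessian W a)) '' B,
      n ≤ M := by
    rintro _ ⟨a, -, rfl⟩
    exact BenignAutoencoder.nuPlus_le _
  refine ⟨_, le_rfl, fun a ha => ?_⟩
  have hle := le_csSup ⟨M, hbound⟩ (mem_image_of_mem _ ha.2)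
  refine BenignAutoencoder.exists_ball_inter_subset_lipschitzGraph hW2 (fun x hx y hy => ?_) a hle
    (csSup_le ⟨_, mem_image_of_mem _ ha.2⟩ hbound)
  exact hτ.map_midpoint_le hg hW.continuous (hint.integrable hg)
    (hint.integrable_map_representation hg hW.continuous hτ.1) hx.1 hy.1
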